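/- Let $G$ be a group. A Boolean ideal on $G$ is a (nonempty) family $\mathcal I$ of subsets of $G$, not containing $G$ itself, such that every subset of $A\cup B$ belongs to $\mathcal I$ whenever $A,B\in\mathcal I$. It is called invariant if $xAy\in\mathcal I$ for all $A\in\mathcal I$ and $x,y\in G$, and $G$-invariant if $gA\in\mathcal I$ for all $A\in\mathcal I$ and $g\in G$. For $A\subset G$ put $\Delta_{\mathcal I}(A)=\{g\in G: gA\cap A\notin\mathcal I\}$. For a nonempty $A\subset G$ and a Boolean ideal $\mathcal J$ on $G$ put $$\mathrm{cov}(A)=\min\{|F|:F\subset G,\ FA=G\},\qquad \mathrm{cov}_{\mathcal J}(A)=\min\{|F|:F\subset G,\ (FA)\,\triangle\, G\in\mathcal J\},$$ and let $\mathrm{cov}(\emptyset)=\mathrm{cov}_{\mathcal J}(\emptyset)=\infty$, which is larger than every cardinal. Theorem. Let $\mathcal I$ be an invariant Boolean ideal on a group $G$ such that some countable (possibly finite) subset of $G$ does not belong to $\mathcal I$. Then for every partition $G=A_1\cup\dots\cup A_n$ of $G$ into finitely many pairwise disjoint sets, at least one of the following holds: (1) $\mathrm{cov}(\Delta_{\mathcal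 I}(A_i))\le n$ for all $i\in\{1,\dots,n\}$; (2) there are an $i\in\{1,\dots,n\}$ and a $G$-invariant Boolean ideal $\mathcal J$ on $G$ such that $A_i^{-1}\notin\mathcal J$ and $\mathrm{cov}_{\mathcal J}(\Delta_{\mathcal I}(A_i))<n$. -/

import Mathlib

open scoped Pointwise

/-!
A Boolean ideal on a set `X` is a proper ideal of the Boolean algebra of all subsets of `X`,
that is, an `I : Order.Ideal (Set X)` with `I.IsProper`.
-/

/-- An ideal of subsets of a `G`-space `X` is `G`-invariant if it is closed under all the
translations `A ↦ g • A`. -/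
def IsGInvariant (G : Type*) {X : Type*} [Group G] [MulAction G X]
    (I : Order.Ideal (Set X)) : Prop :=
  ∀ (g : G) (A : Set X), A ∈ I → g • A ∈ I

/-- An ideal of subsets of a group `G` is invariant if it is closed under all the two-sided
translations `A ↦ x A y`. -/
def IsBiInvariant {G : Type*} [Group G] (I : Order.Ideal (Set G)) : Prop :=
  ∀ (x y : G) (A : Set G), A ∈ I → (fun a => x * a * y) '' A ∈ I

/-- The `I`-difference set `{g ∈ G : gA ∩ A ∉ I}` of a subset `A` of a `G`-space `X`. -/
def diffSet (G : Type*) {X : Type*} [Group G] [MulAction G X]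
    (I : Order.Ideal (Set X)) (A : Set X) : Set G :=
  {g : G | (g • A) ∩ A ∉ I}

/-- `A =_J B`: the symmetric difference of `A` and `B` belongs to `J`. -/
def EqMod {X : Type*} (J : Order.Ideal (Set X)) (A B : Set X) : Prop :=
  symmDiff A B ∈ J

/-- The covering number `min {|F| : F ⊆ G, F A = G}`. It is `⊤`, which is above every cardinal,
if there is no such `F`, that is, if `A` is empty. -/
noncomputable def cov {G : Type*} [Group G] (A : Set G) : WithTop Cardinal :=
  sInf {c | ∃ F : Set G, F * A = Set.univ ∧ c = (Cardinal.mk F : WithTop Cardinal)}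

/-- The `J`-covering number `min {|F| : F ⊆ G, F A =_J G}` of a nonempty set `A`; for the empty
set it is `⊤`, which is above every cardinal. -/
noncomputable def covMod {G : Type*} [Group G] (J : Order.Ideal (Set G)) (A : Set G) :
    WithTop Cardinal :=
  sInf {c | ∃ F : Set G, A.Nonempty ∧ EqMod J (F * A) Set.univ ∧
    c = (Cardinal.mk F : WithTop Cardinal)}

open scoped BoundedContinuousFunction
open Filter Topology

/-- Precomposition of functionals with a continuous linear operator. -/
noncomputable def WeakDual.precomp {E : Type*} [AddCommGroup E] [Module ℝ E] [TopologicalSpace E]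
    (T : E →L[ℝ] E) : WeakDual ℝ E →ₗ[ℝ] WeakDual ℝ E where
  toFun φ := StrongDual.toWeakDual ((WeakDual.toStrongDual φ).comp T)
  map_add' _ _ := rfl
  map_smul' _ _ := rfl

section FixedPoint

variable {E : Type*} [AddCommGroup E] [Module ℝ E] [TopologicalSpace E]

theorem WeakDual.precomp_apply (T : E →L[ℝ] E) (φ : WeakDual ℝ E) (f : E) :
    WeakDual.precomp T φ f = φ (T f) := rfl

theorem WeakDual.continuous_precomp (T : E →L[ℝ] E) : Continuous (WeakDual.precomp T) :=
  WeakDual.continuous_of_continuous_eval fun f => WeakDual.eval_continuous (T f)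

/-- The Markov-Kakutani fixed point theorem for the transpose of one operator. -/
theorem WeakDual.exists_precomp_eq_self (T : E →L[ℝ] E) {L : Set (WeakDual ℝ E)}
    (hL : IsCompact L) (hconv : Convex ℝ L) (hne : L.Nonempty)
    (hT : ∀ φ ∈ L, WeakDual.precomp T φ ∈ L) : ∃ φ ∈ L, WeakDual.precomp T φ = φ := by
  obtain ⟨φ₀, hφ₀⟩ := hne
  let p : ℕ → WeakDual ℝ E := fun k => (WeakDual.precomp T)^[k] φ₀
  have hp : ∀ k, p k ∈ L := fun k => by
    induction k with
    | zero => exact hφ₀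
    | succ k ih => simpa only [p, Function.iterate_succ_apply'] using hT _ ih
  have hstep : ∀ k f, p k (T f) = p (k + 1) f := fun k f => by
    simp only [p, Function.iterate_succ_apply', WeakDual.precomp_apply]
  let c : ℕ → WeakDual ℝ E := fun N => ∑ k ∈ Finset.range (N + 1), ((N : ℝ) + 1)⁻¹ • p k
  have hc : ∀ N, c N ∈ L := fun N => by
    refine hconv.sum_mem (fun _ _ => by positivity) ?_ fun k _ => hp k
    have : (N : ℝ) + 1 ≠ 0 := by positivity
    simp [this]
  have hcf : ∀ N f, c N f = ((N : ℝ) + 1)⁻¹ * ∑ k ∈ Finset.range (N + 1), p k f := fun N f => by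
    have : ∀ s : Finset ℕ, (∑ k ∈ s, ((N : ℝ) + 1)⁻¹ • p k) f
        = ∑ k ∈ s, ((N : ℝ) + 1)⁻¹ * p k f := fun s => by
      induction s using Finset.cons_induction with
      | empty => rfl
      | cons a s ha ih =>
        rw [Finset.sum_cons, Finset.sum_cons, ← ih]
        rfl
    rw [this, Finset.mul_sum]
  obtain ⟨φ, hφ, hlim⟩ := hL.ultrafilter_le_nhds ((hyperfilter ℕ).map c)
    (le_principal_iff.2 (Eventually.of_forall (f := (hyperfilter ℕ : Filter ℕ)) hc))
  refine ⟨φ, hφ, DFunLike.ext _ _ fun f => ?_⟩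
  have hlim' : Tendsto c (hyperfilter ℕ) (𝓝 φ) := hlim
  have ht : Tendsto (fun N => c N (T f) - c N f) (hyperfilter ℕ) (𝓝 (φ (T f) - φ f)) :=
    (((WeakDual.eval_continuous (T f)).tendsto φ).comp hlim').sub
      (((WeakDual.eval_continuous f).tendsto φ).comp hlim')
  obtain ⟨C, hC⟩ := (hL.image (WeakDual.eval_continuous f)).isBounded.exists_norm_le
  have hC' : ∀ k, |p k f| ≤ C := fun k => hC _ ⟨_, hp k, rfl⟩
  have h0 : Tendsto (fun N => c N (T f) - c N f) atTop (𝓝 0) := by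
    have hle : ∀ N : ℕ, ‖c N (T f) - c N f‖ ≤ 2 * C * ((N : ℝ) + 1)⁻¹ := fun N => by
      rw [hcf, hcf, ← mul_sub, ← Finset.sum_sub_distrib]
      simp only [hstep]
      rw [Finset.sum_range_sub (fun k => p k f), norm_mul, mul_comm, Real.norm_eq_abs,
        Real.norm_eq_abs, abs_of_pos (a := ((N : ℝ) + 1)⁻¹) (by positivity)]
      gcongr
      linarith [abs_sub (p (N + 1) f) (p 0 f), hC' (N + 1), hC' 0]
    refine squeeze_zero_norm hle ?_
    have := tendsto_one_div_add_atTop_nhds_zero_nat (𝕜 := ℝ)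
    simpa using this.const_mul (2 * C)
  have := tendsto_nhds_unique ht (h0.mono_left Nat.hyperfilter_le_atTop)
  rw [WeakDual.precomp_apply]
  linarith

end FixedPoint

section Means

variable {G : Type*} [TopologicalSpace G]

variable (G) in
/-- The means (finitely additive probability measures) on a discrete space. -/
def means : Set (WeakDual ℝ (G →ᵇ ℝ)) :=
  {φ | (∀ f : G →ᵇ ℝ, 0 ≤ f → 0 ≤ φ f) ∧ φ 1 = 1}

theorem means_mono {φ : WeakDual ℝ (G →ᵇ ℝ)} (hφ : φ ∈ means G) {f g : G →ᵇ ℝ}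
    (h : ∀ x, f x ≤ g x) : φ f ≤ φ g := by
  have := hφ.1 (g - f) fun x => sub_nonneg.2 (h x)
  rwa [map_sub, sub_nonneg] at this

theorem means_const {φ : WeakDual ℝ (G →ᵇ ℝ)} (hφ : φ ∈ means G) (c : ℝ) :
    φ (c • (1 : G →ᵇ ℝ)) = c := by
  rw [map_smul, hφ.2, smul_eq_mul, mul_one]

theorem means_abs_le {φ : WeakDual ℝ (G →ᵇ ℝ)} (hφ : φ ∈ means G) (f : G →ᵇ ℝ) :
    |φ f| ≤ ‖f‖ := by
  have h : ∀ x, |f x| ≤ ‖f‖ := f.norm_coe_le_norm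
  rw [abs_le]
  constructor
  · rw [← means_const hφ (-‖f‖)]
    exact means_mono hφ fun x => by simpa using (abs_le.1 (h x)).1
  · conv_rhs => rw [← means_const hφ ‖f‖]
    exact means_mono hφ fun x => by simpa using (abs_le.1 (h x)).2

theorem isClosed_means : IsClosed (means G) := by
  have : means G = (⋂ f : G →ᵇ ℝ, ⋂ _ : 0 ≤ f, {φ | 0 ≤ φ f}) ∩ {φ | φ 1 = 1} := by
    ext φ
    simp [means]
  rw [this]
  exact (isClosed_iInter fun f => isClosed_iInter fun _ =>
    isClosed_le continuous_const (WeakDual.eval_continuous f)).inter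
    (isClosed_eq (WeakDual.eval_continuous _) continuous_const)

theorem isCompact_means : IsCompact (means G) := by
  refine (WeakDual.isCompact_closedBall (𝕜 := ℝ) (E := G →ᵇ ℝ) 0 1).of_isClosed_subset
    isClosed_means fun φ hφ => ?_
  rw [Set.mem_preimage, mem_closedBall_zero_iff]
  exact ContinuousLinearMap.opNorm_le_bound _ zero_le_one fun f => by
    rw [one_mul]
    exact means_abs_le hφ f

theorem convex_means : Convex ℝ (means G) := by
  intro φ hφ ψ hψ a b ha hb hab
  refine ⟨fun f hf => ?_, ?_⟩
  · exact add_nonneg (mul_nonneg ha (hφ.1 f hf)) (mul_nonneg hb (hψ.1 f hf))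
  · change a * φ 1 + b * ψ 1 = 1
    rw [hφ.2, hψ.2, mul_one, mul_one, hab]

/-- The mean concentrated at a point. -/
noncomputable def diracMean (x : G) : WeakDual ℝ (G →ᵇ ℝ) :=
  StrongDual.toWeakDual (BoundedContinuousFunction.evalCLM ℝ x)

theorem diracMean_apply (x : G) (f : G →ᵇ ℝ) : diracMean x f = f x := rfl

theorem diracMean_mem_means (x : G) : diracMean x ∈ means G :=
  ⟨fun _ hf => hf x, rfl⟩

variable [DiscreteTopology G]

/-- The indicator function of a subset of a discrete space. -/
noncomputable def ind (A : Set G) : G →ᵇ ℝ :=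
  BoundedContinuousFunction.indicator A (isClopen_discrete A)

theorem ind_apply (A : Set G) (x : G) : ind A x = A.indicator (fun _ => (1 : ℝ)) x := rfl

theorem ind_empty : ind (∅ : Set G) = 0 := by
  ext x
  simp [ind_apply]

theorem ind_univ : ind (Set.univ : Set G) = 1 := by
  ext x
  simp [ind_apply]

theorem ind_union_add_ind_inter (A B : Set G) :
    ind (A ∪ B) + ind (A ∩ B) = ind A + ind B := by
  ext x
  simp only [BoundedContinuousFunction.coe_add, Pi.add_apply, ind_apply]
  exact Set.indicator_union_add_inter_apply _ A B x

theorem means_ind_nonneg {φ : WeakDual ℝ (G →ᵇ ℝ)} (hφ : φ ∈ means G) (A : Set G) :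
    0 ≤ φ (ind A) :=
  hφ.1 _ fun x => Set.indicator_nonneg (fun _ _ => zero_le_one) x

theorem means_ind_mono {φ : WeakDual ℝ (G →ᵇ ℝ)} (hφ : φ ∈ means G) {A B : Set G}
    (h : A ⊆ B) : φ (ind A) ≤ φ (ind B) :=
  means_mono hφ fun x =>
    Set.indicator_le_indicator_of_subset h (fun _ => zero_le_one) x

theorem means_ind_le_one {φ : WeakDual ℝ (G →ᵇ ℝ)} (hφ : φ ∈ means G) (A : Set G) :
    φ (ind A) ≤ 1 := by
  have := means_ind_mono hφ (Set.subset_univ A)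
  rwa [ind_univ, hφ.2] at this

theorem means_ind_union {φ : WeakDual ℝ (G →ᵇ ℝ)} (A B : Set G) :
    φ (ind (A ∪ B)) + φ (ind (A ∩ B)) = φ (ind A) + φ (ind B) := by
  rw [← map_add, ind_union_add_ind_inter, map_add]

/-- Where a function attains its upper bound on average, it is bounded away from that bound only
on a null set. -/
theorem means_ind_le_eq_zero {φ : WeakDual ℝ (G →ᵇ ℝ)} (hφ : φ ∈ means G) {f : G →ᵇ ℝ} {a b : ℝ}
    (hba : b < a) (hf : ∀ x, f x ≤ a) (hfa : φ f = a) : φ (ind {x | f x ≤ b}) = 0 := by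
  refine le_antisymm ?_ (means_ind_nonneg hφ _)
  have h : φ ((a - b) • ind {x | f x ≤ b}) ≤ φ (a • (1 : G →ᵇ ℝ) - f) := by
    refine means_mono hφ fun x => ?_
    by_cases hx : f x ≤ b
    · simpa [ind_apply, hx] using by linarith
    · simp [ind_apply, hx, hf x]
  rw [map_smul, map_sub, means_const hφ, hfa, sub_self, smul_eq_mul] at h
  nlinarith

theorem means_sum_of_partition {φ : WeakDual ℝ (G →ᵇ ℝ)} (hφ : φ ∈ means G) {ι : Type*} [Fintype ι]
    {A : ι → Set G} (hdisj : Pairwise fun i j => Disjoint (A i) (A j))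
    (hcover : ⋃ i, A i = Set.univ) : ∑ i, φ (ind (A i)) = 1 := by
  rw [← map_sum, ← hφ.2]
  congr 1
  ext x
  obtain ⟨i, hi⟩ := Set.mem_iUnion.1 (hcover ▸ Set.mem_univ x)
  rw [BoundedContinuousFunction.coe_sum, Finset.sum_apply, Finset.sum_eq_single i]
  · simp [ind_apply, hi]
  · intro j _ hj
    simpa [ind_apply] using Set.disjoint_right.1 (hdisj hj) hi
  · simp

/-- The means vanishing on an ideal of subsets. -/
def nullMeans (I : Order.Ideal (Set G)) : Set (WeakDual ℝ (G →ᵇ ℝ)) :=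
  {φ | φ ∈ means G ∧ ∀ B ∈ I, φ (ind B) = 0}

theorem isClosed_nullMeans (I : Order.Ideal (Set G)) : IsClosed (nullMeans I) := by
  have : nullMeans I = means G ∩ ⋂ B ∈ I, {φ | φ (ind B) = 0} := by
    ext φ
    simp [nullMeans]
  rw [this]
  exact isClosed_means.inter (isClosed_iInter fun B => isClosed_iInter fun _ =>
    isClosed_eq (WeakDual.eval_continuous _) continuous_const)

theorem convex_nullMeans (I : Order.Ideal (Set G)) : Convex ℝ (nullMeans I) := by
  intro φ hφ ψ hψ a b ha hb hab
  refine ⟨convex_means hφ.1 hψ.1 ha hb hab, fun B hB => ?_⟩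
  change a * φ (ind B) + b * ψ (ind B) = 0
  rw [hφ.2 B hB, hψ.2 B hB, mul_zero, mul_zero, add_zero]

theorem nullMeans_nonempty (I : Order.Ideal (Set G)) (hI : I.IsProper) :
    (nullMeans I).Nonempty := by
  have huniv : Set.univ ∉ I := fun h => hI.ne_univ
    (Set.eq_univ_of_forall fun B => I.lower (Set.subset_univ B) h)
  let F : Filter G := Filter.comk (fun B => B ∈ I) I.bot_mem
    (fun t ht s hst => I.lower hst ht) (fun s hs t ht => Order.Ideal.sup_mem hs ht)
  have hF : F.NeBot := by
    refine Filter.neBot_iff.2 fun h => huniv ?_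
    have : (∅ : Set G) ∈ F := h ▸ Filter.mem_bot
    simpa [F, Filter.mem_comk] using this
  obtain ⟨φ, hφ, hlim⟩ := isCompact_means.ultrafilter_le_nhds ((Ultrafilter.of F).map diracMean)
    (le_principal_iff.2
      (Eventually.of_forall (f := (Ultrafilter.of F : Filter G)) diracMean_mem_means))
  have hlim' : Tendsto diracMean (Ultrafilter.of F) (𝓝 φ) := hlim
  refine ⟨φ, hφ, fun B hB => ?_⟩
  refine tendsto_nhds_unique (((WeakDual.eval_continuous (ind B)).tendsto φ).comp hlim') ?_
  refine tendsto_const_nhds.congr' ?_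
  have hBF : Bᶜ ∈ Ultrafilter.of F :=
    Ultrafilter.of_le F (by simpa [F, Filter.mem_comk] using hB)
  filter_upwards [hBF] with x hx
  exact (Set.indicator_of_notMem hx _).symm

theorem sum_ind_le_one {ι : Type*} {I : Order.Ideal (Set G)} {φ : WeakDual ℝ (G →ᵇ ℝ)}
    (hφ : φ ∈ nullMeans I) (B : ι → Set G) (F : Finset ι)
    (hF : (F : Set ι).Pairwise fun s t => B s ∩ B t ∈ I) : ∑ s ∈ F, φ (ind (B s)) ≤ 1 := by
  classical
  suffices h : ∑ s ∈ F, φ (ind (B s)) = φ (ind (⋃ s ∈ F, B s)) from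
    h.trans_le (means_ind_le_one hφ.1 _)
  induction F using Finset.cons_induction with
  | empty => simp [ind_empty]
  | cons a F ha ih =>
    rw [Finset.coe_cons] at hF
    have hnull : ∀ F' ⊆ F, B a ∩ ⋃ s ∈ F', B s ∈ I := fun F' => by
      induction F' using Finset.cons_induction with
      | empty => simpa using I.bot_mem
      | cons b F' hb ih' =>
        intro hsub
        have hbF : b ∈ F := hsub (Finset.mem_cons_self b F')
        have h1 := hF (Set.mem_insert a _) (Set.mem_insert_of_mem _ hbF) (by
          rintro rfl
          exact ha hbF)
        have h2 := ih' fun s hs => hsub (Finset.mem_cons_of_mem hs)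
        rw [Finset.cons_eq_insert, Finset.set_biUnion_insert, Set.inter_union_distrib_left]
        exact Order.Ideal.sup_mem h1 h2
    have := means_ind_union (φ := φ) (B a) (⋃ s ∈ F, B s)
    rw [hφ.2 _ (hnull F subset_rfl), add_zero] at this
    rw [Finset.sum_cons, ih (hF.mono (Set.subset_insert _ _)), Finset.cons_eq_insert,
      Finset.set_biUnion_insert, this]

end Means

section Convolution

variable {G : Type*} [Group G] [TopologicalSpace G] [DiscreteTopology G]

/-- The left translate `y ↦ f (x y)` of a bounded function. -/
noncomputable def leftTranslate (x : G) (f : G →ᵇ ℝ) : G →ᵇ ℝ :=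
  f.compContinuous ⟨fun y => x * y, continuous_of_discreteTopology⟩

theorem leftTranslate_apply (x y : G) (f : G →ᵇ ℝ) : leftTranslate x f y = f (x * y) := rfl

theorem norm_leftTranslate_le (x : G) (f : G →ᵇ ℝ) : ‖leftTranslate x f‖ ≤ ‖f‖ :=
  f.norm_compContinuous_le _

theorem leftTranslate_ind (x : G) (A : Set G) : leftTranslate x (ind A) = ind (x⁻¹ • A) := by
  ext y
  have h : y ∈ x⁻¹ • A ↔ x * y ∈ A := Set.mem_inv_smul_set_iff
  by_cases hy : x * y ∈ A
  · simp [leftTranslate_apply, ind_apply, hy, h.2 hy]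
  · simp [leftTranslate_apply, ind_apply, hy, h]

/-- The operator `f ↦ (x ↦ φ (f (x ·)))` on bounded functions. -/
noncomputable def convOp (φ : WeakDual ℝ (G →ᵇ ℝ)) : (G →ᵇ ℝ) →L[ℝ] (G →ᵇ ℝ) :=
  LinearMap.mkContinuous
    { toFun := fun f => BoundedContinuousFunction.ofNormedAddCommGroupDiscrete
        (fun x => φ (leftTranslate x f)) (‖WeakDual.toStrongDual φ‖ * ‖f‖) fun x =>
          ((WeakDual.toStrongDual φ).le_opNorm _).trans
            (mul_le_mul_of_nonneg_left (norm_leftTranslate_le x f) (norm_nonneg _))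
      map_add' := fun f g => by
        ext x
        exact map_add φ (leftTranslate x f) (leftTranslate x g)
      map_smul' := fun c f => by
        ext x
        exact map_smul φ c (leftTranslate x f) }
    ‖WeakDual.toStrongDual φ‖ fun f =>
      (BoundedContinuousFunction.norm_le (by positivity)).2 fun x =>
        ((WeakDual.toStrongDual φ).le_opNorm _).trans
          (mul_le_mul_of_nonneg_left (norm_leftTranslate_le x f) (norm_nonneg _))

theorem convOp_apply (φ : WeakDual ℝ (G →ᵇ ℝ)) (f : G →ᵇ ℝ) (x : G) :
    convOp φ f x = φ (leftTranslate x f) := rfl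

/-- Convolution of functionals on bounded functions:
`conv φ ψ` maps `f` to `φ (x ↦ ψ (y ↦ f (x y)))`. -/
noncomputable def conv (φ ψ : WeakDual ℝ (G →ᵇ ℝ)) : WeakDual ℝ (G →ᵇ ℝ) :=
  WeakDual.precomp (convOp ψ) φ

theorem conv_apply (φ ψ : WeakDual ℝ (G →ᵇ ℝ)) (f : G →ᵇ ℝ) : conv φ ψ f = φ (convOp ψ f) := rfl

theorem conv_assoc (φ ψ χ : WeakDual ℝ (G →ᵇ ℝ)) :
    conv (conv φ ψ) χ = conv φ (conv ψ χ) := by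
  refine DFunLike.ext _ _ fun f => ?_
  simp only [conv_apply]
  congr 1
  ext x
  simp only [convOp_apply, conv_apply]
  congr 1
  ext y
  simp only [convOp_apply, leftTranslate_apply]
  congr 1
  ext z
  simp only [leftTranslate_apply, mul_assoc]

theorem conv_mem_means {φ ψ : WeakDual ℝ (G →ᵇ ℝ)} (hφ : φ ∈ means G) (hψ : ψ ∈ means G) :
    conv φ ψ ∈ means G := by
  refine ⟨fun f hf => hφ.1 _ fun x => hψ.1 (leftTranslate x f) fun y => hf (x * y), ?_⟩
  rw [conv_apply, ← hφ.2]
  congr 1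
  ext x
  exact hψ.2

theorem conv_dirac_ind (g : G) (φ : WeakDual ℝ (G →ᵇ ℝ)) (A : Set G) :
    conv (diracMean g) φ (ind A) = φ (ind (g⁻¹ • A)) := by
  rw [conv_apply, diracMean_apply, convOp_apply, leftTranslate_ind]

theorem conv_mem_nullMeans {I : Order.Ideal (Set G)} (hinv : IsGInvariant G I)
    {φ ψ : WeakDual ℝ (G →ᵇ ℝ)} (hφ : φ ∈ means G) (hψ : ψ ∈ nullMeans I) :
    conv φ ψ ∈ nullMeans I := by
  refine ⟨conv_mem_means hφ hψ.1, fun B hB => ?_⟩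
  have : convOp ψ (ind B) = 0 := by
    ext x
    rw [convOp_apply, leftTranslate_ind]
    exact hψ.2 _ (hinv _ _ hB)
  rw [conv_apply, this, map_zero]

/-- The means vanishing on an invariant ideal contain a compact left ideal of the convolution
semigroup of all means in which `conv φ ψ = φ`. -/
theorem exists_leftZero_ideal (I : Order.Ideal (Set G)) (hI : I.IsProper)
    (hinv : IsGInvariant G I) :
    ∃ L ⊆ nullMeans I, L.Nonempty ∧ IsCompact L ∧ (∀ φ ∈ means G, ∀ ψ ∈ L, conv φ ψ ∈ L) ∧
      ∀ φ ∈ L, ∀ ψ ∈ L, conv φ ψ = φ := by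
  let S : Set (Set (WeakDual ℝ (G →ᵇ ℝ))) := {L | L ⊆ nullMeans I ∧ L.Nonempty ∧ IsClosed L ∧
    Convex ℝ L ∧ ∀ φ ∈ means G, ∀ ψ ∈ L, conv φ ψ ∈ L}
  have hcpt : ∀ L ∈ S, IsCompact L := fun L hL =>
    isCompact_means.of_isClosed_subset hL.2.2.1 fun φ hφ => (hL.1 hφ).1
  obtain ⟨L, -, hL⟩ := zorn_superset_nonempty S (fun c hcS hc hne => by
    refine ⟨⋂₀ c, ⟨?_, ?_, ?_, ?_, ?_⟩, fun s hs => Set.sInter_subset_of_mem hs⟩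
    · obtain ⟨s, hs⟩ := hne
      exact (Set.sInter_subset_of_mem hs).trans (hcS hs).1
    · have := hne.to_subtype
      exact IsCompact.nonempty_sInter_of_directed_nonempty_isCompact_isClosed
        (show IsChain (· ⊇ ·) c from hc.symm).directedOn (fun s hs => (hcS hs).2.1) (fun s hs => hcpt s (hcS hs))
        (fun s hs => (hcS hs).2.2.1)
    · exact isClosed_sInter fun s hs => (hcS hs).2.2.1
    · exact convex_sInter fun s hs => (hcS hs).2.2.2.1
    · exact fun φ hφ ψ hψ s hs => (hcS hs).2.2.2.2 φ hφ ψ (hψ s hs))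
    (nullMeans I) ⟨subset_rfl, nullMeans_nonempty I hI, isClosed_nullMeans I, convex_nullMeans I,
      fun φ hφ ψ hψ => conv_mem_nullMeans hinv hφ hψ⟩
  have hLS := hL.prop
  have hgen : ∀ ψ ∈ L, ∀ φ ∈ L, ∃ χ ∈ means G, conv χ ψ = φ := by
    intro ψ hψ
    have hsub : (WeakDual.precomp (convOp ψ)) '' means G ⊆ L := by
      rintro _ ⟨χ, hχ, rfl⟩
      exact hLS.2.2.2.2 χ hχ ψ hψ
    refine hL.le_of_le (y := (WeakDual.precomp (convOp ψ)) '' means G)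
      ⟨hsub.trans hLS.1, ⟨_, ψ, (hLS.1 hψ).1, rfl⟩, ?_, ?_, ?_⟩ hsub
    · exact (isCompact_means.image (WeakDual.continuous_precomp _)).isClosed
    · exact convex_means.linear_image _
    · rintro φ hφ _ ⟨χ, hχ, rfl⟩
      exact ⟨conv φ χ, conv_mem_means hφ hχ, conv_assoc φ χ ψ⟩
  refine ⟨L, hLS.1, hLS.2.1, hcpt L hLS, hLS.2.2.2.2, fun φ hφ ψ hψ => ?_⟩
  obtain ⟨z, hz, hzψ⟩ := WeakDual.exists_precomp_eq_self (convOp ψ) (hcpt L hLS) hLS.2.2.2.1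
    hLS.2.1 fun χ hχ => hLS.2.2.2.2 χ (hLS.1 hχ).1 ψ hψ
  obtain ⟨χ, -, rfl⟩ := hgen z hz φ hφ
  rw [conv_assoc]
  congr 1

end Convolution

section Packing

variable {G : Type*} [Group G] [TopologicalSpace G] [DiscreteTopology G]

/-- A maximal family of almost disjoint translates, taken among the translates whose measure is
at least `c`, shows that those translates are covered by finitely many translates of the difference
set. -/
theorem exists_finset_cover_diffSet {I : Order.Ideal (Set G)} (hinv : IsGInvariant G I)
    {φ : WeakDual ℝ (G →ᵇ ℝ)} (hφ : φ ∈ nullMeans I) (A S : Set G) {c : ℝ} (hc : 0 < c)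
    (hS : ∀ s ∈ S, c ≤ φ (ind (s • A))) :
    ∃ F : Finset G, (F : Set G) ⊆ S ∧ ∑ s ∈ F, φ (ind (s • A)) ≤ 1 ∧
      S ⊆ (F : Set G) * diffSet G I A := by
  classical
  let K : Set ℕ := {k | ∃ F : Finset G, (F : Set G) ⊆ S ∧
    ((F : Set G).Pairwise fun s t => s • A ∩ t • A ∈ I) ∧ F.card = k}
  have hKne : K.Nonempty := ⟨0, ∅, by simp, by simp, rfl⟩
  have hKbdd : BddAbove K := by
    obtain ⟨N, hN⟩ := exists_nat_ge c⁻¹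
    refine ⟨N, ?_⟩
    rintro _ ⟨F, hFS, hF, rfl⟩
    have h1 := sum_ind_le_one hφ (fun s => s • A) F hF
    have h2 := Finset.card_nsmul_le_sum F (fun s => φ (ind (s • A))) c fun s hs => hS s (hFS hs)
    rw [nsmul_eq_mul] at h2
    have : (F.card : ℝ) ≤ N := (le_div_iff₀ hc |>.2 (h2.trans h1)).trans (by simpa using hN)
    exact_mod_cast this
  obtain ⟨F, hFS, hF, hcard⟩ := Nat.sSup_mem hKne hKbdd
  refine ⟨F, hFS, sum_ind_le_one hφ _ F hF, fun s hs => ?_⟩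
  obtain ⟨t, ht, hst⟩ : ∃ t ∈ F, s • A ∩ t • A ∉ I := by
    by_cases hsF : s ∈ F
    · refine ⟨s, hsF, fun h => ?_⟩
      rw [Set.inter_self] at h
      linarith [hS s hs, hφ.2 _ h]
    · by_contra! h
      have hmem : F.card + 1 ∈ K := by
        refine ⟨insert s F, ?_, ?_, Finset.card_insert_of_notMem hsF⟩
        · rw [Finset.coe_insert]
          exact Set.insert_subset hs hFS
        · rw [Finset.coe_insert]
          refine hF.insert fun t ht _ => ⟨h t ht, ?_⟩
          rw [Set.inter_comm]
          exact h t ht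
      have := le_csSup hKbdd hmem
      omega
  refine ⟨t, ht, t⁻¹ * s, fun h => hst ?_, by simp⟩
  have := hinv t _ h
  rwa [Set.smul_set_inter, ← mul_smul, mul_inv_cancel_left] at this

end Packing

/-- The sets all of whose left translates have a null inverse, for a given mean. -/
noncomputable def invNullIdeal {G : Type*} [Group G] [TopologicalSpace G] [DiscreteTopology G]
    {φ : WeakDual ℝ (G →ᵇ ℝ)} (hφ : φ ∈ means G) : Order.Ideal (Set G) where
  carrier := {B | ∀ g : G, φ (ind (g • B)⁻¹) = 0}
  lower' := fun B C hCB hB g => le_antisymm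
    ((means_ind_mono hφ (Set.inv_subset_inv.2 (Set.smul_set_mono hCB))).trans (hB g).le)
    (means_ind_nonneg hφ _)
  nonempty' := ⟨∅, fun g => by rw [Set.smul_set_empty, Set.inv_empty, ind_empty, map_zero]⟩
  directed' := fun B hB C hC => ⟨B ∪ C, fun g => by
    rw [Set.smul_set_union, Set.union_inv]
    have h := means_ind_union (φ := φ) (g • B)⁻¹ (g • C)⁻¹
    rw [hB g, hC g] at h
    linarith [means_ind_nonneg hφ ((g • B)⁻¹ ∪ (g • C)⁻¹),
      means_ind_nonneg hφ ((g • B)⁻¹ ∩ (g • C)⁻¹)], Set.subset_union_left, Set.subset_union_right⟩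

section InvNullIdeal

variable {G : Type*} [Group G] [TopologicalSpace G] [DiscreteTopology G]
  {φ : WeakDual ℝ (G →ᵇ ℝ)} (hφ : φ ∈ means G)

theorem mem_invNullIdeal {B : Set G} :
    B ∈ invNullIdeal hφ ↔ ∀ g : G, φ (ind (g • B)⁻¹) = 0 := Iff.rfl

theorem inv_notMem_invNullIdeal {A : Set G} (hA : φ (ind A) ≠ 0) : A⁻¹ ∉ invNullIdeal hφ :=
  fun h => hA (by simpa using (mem_invNullIdeal hφ).1 h 1)

theorem invNullIdeal_isProper : (invNullIdeal hφ).IsProper :=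
  Order.Ideal.isProper_of_notMem (p := Set.univ⁻¹)
    (inv_notMem_invNullIdeal hφ (by rw [ind_univ, hφ.2]; exact one_ne_zero))

theorem invNullIdeal_isGInvariant : IsGInvariant G (invNullIdeal hφ) := fun g B hB h => by
  rw [← mul_smul]
  exact hB (h * g)

end InvNullIdeal

theorem IsBiInvariant.isGInvariant {G : Type*} [Group G] {I : Order.Ideal (Set G)}
    (hI : IsBiInvariant I) : IsGInvariant G I := fun g A hA => by
  have h := hI g 1 A hA
  simp only [mul_one] at h
  exact h

theorem cov_le_card {G : Type*} [Group G] {A : Set G} (F : Finset G)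
    (hF : (F : Set G) * A = Set.univ) {n : ℕ} (hn : F.card ≤ n) :
    cov A ≤ (n : WithTop Cardinal) := by
  refine le_trans (b := (Cardinal.mk (F : Set G) : WithTop Cardinal)) (sInf_le ⟨F, hF, rfl⟩) ?_
  have : Cardinal.mk (F : Set G) ≤ (n : Cardinal) := by
    simpa using hn
  exact WithTop.coe_le_coe.2 this

theorem covMod_lt_of_card_lt {G : Type*} [Group G] {J : Order.Ideal (Set G)} {A : Set G}
    (hA : A.Nonempty) (F : Finset G) (hF : ((F : Set G) * A)ᶜ ∈ J) {n : ℕ} (hn : F.card < n) :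
    covMod J A < (n : WithTop Cardinal) := by
  refine lt_of_le_of_lt (b := (Cardinal.mk (F : Set G) : WithTop Cardinal))
    (sInf_le ⟨F, hA, ?_, rfl⟩) ?_
  · unfold EqMod
    rwa [← Set.top_eq_univ, symmDiff_top]
  · have : Cardinal.mk (F : Set G) < (n : Cardinal) := by
      simpa using hn
    exact WithTop.coe_lt_coe.2 this

theorem theorem2 {G : Type*} [Group G] (I : Order.Ideal (Set G)) (hI : I.IsProper)
    (hinv : IsBiInvariant I) (hctbl : ∃ C : Set G, C.Countable ∧ C ∉ I)
    (n : ℕ) (A : Fin n → Set G)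
    (hdisj : Pairwise fun i j => Disjoint (A i) (A j)) (hcover : ⋃ i, A i = Set.univ) :
    (∀ i, cov (diffSet G I (A i)) ≤ (n : WithTop Cardinal)) ∨
    (∃ i, ∃ J : Order.Ideal (Set G), J.IsProper ∧ IsGInvariant G J ∧ (A i)⁻¹ ∉ J ∧
      covMod J (diffSet G I (A i)) < (n : WithTop Cardinal)) := by
  let _ : TopologicalSpace G := ⊥
  have : DiscreteTopology G := ⟨rfl⟩
  have hG := hinv.isGInvariant
  obtain ⟨L, hLI, hLne, hLcpt, hLmul, hLzero⟩ := exists_leftZero_ideal I hI hG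
  have hn : 0 < (n : ℝ) := by
    obtain ⟨i, -⟩ := Set.mem_iUnion.1 (hcover ▸ Set.mem_univ (1 : G))
    exact_mod_cast i.pos
  have htr : ∀ g : G, ∀ φ ∈ L, conv (diracMean g) φ ∈ L :=
    fun g φ hφ => hLmul _ (diracMean_mem_means g) φ hφ
  by_cases hbig : ∃ i, ∃ φ ∈ L, 1 / (n : ℝ) < φ (ind (A i))
  · right
    obtain ⟨i, φ₀, hφ₀, hφ₀i⟩ := hbig
    obtain ⟨φ, hφ, hmax⟩ := hLcpt.exists_isMaxOn hLne
      (WeakDual.eval_continuous (ind (A i))).continuousOn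
    have hφm := (hLI hφ).1
    have hφi : 1 / (n : ℝ) < φ (ind (A i)) := hφ₀i.trans_le (hmax hφ₀)
    have hpos : 0 < φ (ind (A i)) := lt_trans (by positivity) hφi
    let S : Set G := {s | 1 / (n : ℝ) < φ (ind (s • A i))}
    obtain ⟨F, hFS, hFsum, hFcov⟩ := exists_finset_cover_diffSet hG (hLI hφ) (A i) S
      (c := 1 / (n : ℝ)) (by positivity) fun s hs => le_of_lt hs
    have hSJ : Sᶜ ∈ invNullIdeal hφm := fun g => by
      have hψ := htr g φ hφ
      have hint : φ (convOp (conv (diracMean g) φ) (ind (A i))) = φ (ind (A i)) := by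
        rw [← conv_apply, hLzero φ hφ _ hψ]
      have hle : ∀ x, convOp (conv (diracMean g) φ) (ind (A i)) x ≤ φ (ind (A i)) := fun x =>
        hmax (htr x _ hψ)
      rw [← means_ind_le_eq_zero hφm hφi hle hint]
      congr 2
      ext x
      rw [Set.mem_inv, Set.mem_smul_set_iff_inv_smul_mem, Set.mem_compl_iff, Set.mem_ofPred_eq,
        Set.mem_ofPred_eq, not_lt, convOp_apply, leftTranslate_ind, conv_dirac_ind, smul_eq_mul,
        mul_smul]
    have hne : (diffSet G I (A i)).Nonempty := by
      have h1 : (1 : G) ∈ S := by simpa [S] using hφi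
      exact (hFcov h1 |> fun ⟨_, _, d, hd, _⟩ => ⟨d, hd⟩)
    have hcard : F.card < n := by
      rcases F.eq_empty_or_nonempty with rfl | hF
      · simpa using hn
      · have h := Finset.sum_lt_sum_of_nonempty hF fun s hs =>
          show 1 / (n : ℝ) < φ (ind (s • A i)) from hFS hs
        rw [Finset.sum_const, nsmul_eq_mul, mul_one_div] at h
        have := (div_lt_one hn).1 (h.trans_le hFsum)
        exact_mod_cast this
    exact ⟨i, invNullIdeal hφm, invNullIdeal_isProper hφm, invNullIdeal_isGInvariant hφm,
      inv_notMem_invNullIdeal hφm hpos.ne',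
      covMod_lt_of_card_lt hne F
        ((invNullIdeal hφm).lower (Set.compl_subset_compl.2 hFcov) hSJ) hcard⟩
  · left
    intro i
    push Not at hbig
    have heq : ∀ φ ∈ L, φ (ind (A i)) = 1 / (n : ℝ) := fun φ hφ => by
      have hsum : ∑ j, φ (ind (A j)) = ∑ _j : Fin n, 1 / (n : ℝ) := by
        rw [means_sum_of_partition (hLI hφ).1 hdisj hcover]
        simp [hn.ne']
      exact (Finset.sum_eq_sum_iff_of_le fun j _ => hbig j φ hφ).1 hsum i (Finset.mem_univ i)
    obtain ⟨φ, hφ⟩ := hLne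
    have htrans : ∀ s : G, φ (ind (s • A i)) = 1 / (n : ℝ) := fun s => by
      rw [← heq _ (htr s⁻¹ φ hφ), conv_dirac_ind, inv_inv]
    obtain ⟨F, -, hFsum, hFcov⟩ := exists_finset_cover_diffSet hG (hLI hφ) (A i) Set.univ
      (c := 1 / (n : ℝ)) (by positivity) fun s _ => (htrans s).ge
    refine cov_le_card F (Set.univ_subset_iff.1 hFcov) ?_
    simp only [htrans, Finset.sum_const, nsmul_eq_mul, mul_one_div] at hFsum
    exact_mod_cast (div_le_one hn).1 hFsum
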